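/- Let $\theta$ be an indeterminate, let $h_r$ ($r\ge 0$) be the complete homogeneous symmetric functions in infinitely many variables (so $h_0=1$), put $h_a=0$ for $a<0$, and let $\Lambda_\theta=\mathbb Q[\theta][h_1,h_2,\dots]$ be the ring of symmetric functions over $\mathbb Q[\theta]$. For an integer vector $\alpha=(\alpha_1,\dots,\alpha_\ell)$ put $h_\alpha=h_{\alpha_1}\cdots h_{\alpha_\ell}$, and for $1\le i<j\le \ell$ let the raising and lowering operators act on integer vectors by $$R_{ij}\alpha=(\dots,\alpha_i+1,\dots,\alpha_j-1,\dots),\qquad L_{ij}\alpha=(\dots,\alpha_i-1,\dots,\alpha_j-1,\dots),$$ with $R_{ij}h_\alpha=h_{R_{ij}\alpha}$ and $L_{ij}h_\alpha=h_{L_{ij}\alpha}$; a product of such operators is first applied to the index $\alpha$, and only then is $h_\alpha$ evaluated in $\Lambda_\theta$. For a partition $\lambda$ with $\ell$ nonzero parts, the $\imath$Schur function is $$s^\imath_\lambda=\prod_{1\le i<j\le \ell}(1-\theta L_{ij})(1-R_{ij})\,h_\lambda\ \in\ \Lambda_\theta .$$ For partitions $\nu,\mu$ write $\nu\to\mu$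 if $\nu_i\le\mu_i$ for all $i$ and $\mu-\nu$ is a horizontal strip (at most one box in each column), and set $$N^\lambda_{\mu,r}=\#\{\nu \text{ a partition} : \nu\to\mu,\ \nu\to\lambda,\ |\mu-\nu|+|\lambda-\nu|=r\}.$$ Then for every integer $r\ge 1$ and every partition $\mu$, $$s^\imath_\mu\cdot h_r=\sum_{a=0}^{r}\ \sum_{\lambda\vdash |\mu|+r-2a}\theta^a\,N^\lambda_{\mu,r}\,s^\imath_\lambda ,$$ where the inner sum is over all partitions of the integer $|\mu|+r-2a$ (and is empty if this integer is negative). -/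

import Mathlib

noncomputable section

namespace ISchur

open Polynomial

/-! ### The ring of symmetric functions over `ℚ[θ]` -/

/-- The parameter `θ`: the variable of the coefficient ring `ℚ[θ]`. -/
def theta : ℚ[X] := X

/-- The complete homogeneous symmetric function of degree `n` in the variables `x₀, x₁, x₂, …`:
the formal sum of all monomials of degree `n`. -/
def completeHomogeneous (n : ℕ) : MvPowerSeries ℕ ℚ[X] :=
  fun m => if m.degree = n then 1 else 0

/-- The ring `Λ_θ = ℚ[θ][h₁, h₂, …]` of symmetric functions over `ℚ[θ]`. -/
def SymFun : Subalgebra ℚ[X] (MvPowerSeries ℕ ℚ[X]) :=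
  Algebra.adjoin ℚ[X] (Set.range completeHomogeneous)

/-- `h_n` as an element of `Λ_θ`, for `n ≥ 0`. -/
def hNat (n : ℕ) : SymFun :=
  ⟨completeHomogeneous n, Algebra.subset_adjoin ⟨n, rfl⟩⟩

/-- `h_a` for an integer `a`, with `h_a = 0` for `a < 0`. -/
def hInt (a : ℤ) : SymFun :=
  if 0 ≤ a then hNat a.toNat else 0

/-- `h_α = h_{α₁} h_{α₂} ⋯ h_{α_ℓ}` for an integer vector `α`. -/
def hVec {l : ℕ} (α : Fin l → ℤ) : SymFun :=
  ∏ i, hInt (α i)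

/-! ### Raising and lowering operators

Operators on integer vectors of length `l` are elements of the group algebra `ℚ[θ][ℤ^l]`: the basis
element of `γ ∈ ℤ^l` is the shift `α ↦ α + γ`. -/

/-- Operators that are `ℚ[θ]`-combinations of shifts of integer vectors of length `l`. -/
abbrev ShiftOp (l : ℕ) : Type := AddMonoidAlgebra ℚ[X] (Fin l → ℤ)

/-- The raising operator `R_{ij}`: `α_i ↦ α_i + 1`, `α_j ↦ α_j - 1`. -/
def raising {l : ℕ} (i j : Fin l) : ShiftOp l :=
  AddMonoidAlgebra.single (Pi.single i 1 - Pi.single j 1) 1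

/-- The lowering operator `L_{ij}`: `α_i ↦ α_i - 1`, `α_j ↦ α_j - 1`. -/
def lowering {l : ℕ} (i j : Fin l) : ShiftOp l :=
  AddMonoidAlgebra.single (-Pi.single i 1 - Pi.single j 1) 1

/-- The action of an operator on `h_α`, with the shift by `γ` sending `h_α` to `h_{α + γ}`. -/
def actOnH {l : ℕ} (D : ShiftOp l) (α : Fin l → ℤ) : SymFun :=
  D.coeff.sum fun γ c => c • hVec (α + γ)

/-- The operator `∏_{1 ≤ i < j ≤ l} (1 - θ L_{ij}) (1 - R_{ij})`. -/
def giambelliOp (l : ℕ) : ShiftOp l :=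
  ∏ p : Fin l × Fin l with p.1 < p.2,
    (1 - theta • lowering p.1 p.2) * (1 - raising p.1 p.2)

/-! ### `ı`Schur functions -/

/-- The `ı`Schur function `s^ı_λ = ∏_{i < j} (1 - θ L_{ij}) (1 - R_{ij}) h_λ`. Here `lam.colLen 0` is
the number of nonzero parts of `λ` and `lam.rowLen i` are its parts. -/
def iSchur (lam : YoungDiagram) : SymFun :=
  actOnH (giambelliOp (lam.colLen 0)) fun i => (lam.rowLen i : ℤ)

/-! ### Partitions and horizontal strips -/

/-- There are finitely many partitions of a given integer. -/
theorem finite_partitions (n : ℤ) : {lam : YoungDiagram | (lam.card : ℤ) = n}.Finite := by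
  have key : ∀ lam : YoungDiagram,
      lam.cells ⊆ Finset.range lam.card ×ˢ Finset.range lam.card := by
    rintro lam ⟨i, j⟩ hc
    have hc' : (i, j) ∈ lam := hc
    have hcol : i < lam.colLen j := YoungDiagram.mem_iff_lt_colLen.1 hc'
    have hrow : j < lam.rowLen i := YoungDiagram.mem_iff_lt_rowLen.1 hc'
    rw [YoungDiagram.colLen_eq_card] at hcol
    rw [YoungDiagram.rowLen_eq_card] at hrow
    have h1 : (lam.col j).card ≤ lam.card := Finset.card_le_card (Finset.filter_subset _ _)
    have h2 : (lam.row i).card ≤ lam.card := Finset.card_le_card (Finset.filter_subset _ _)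
    simp only [Finset.mem_product, Finset.mem_range]
    omega
  refine Set.Finite.of_finite_image (f := YoungDiagram.cells) ?_
    (fun a _ b _ h => YoungDiagram.ext h)
  refine (Finset.finite_toSet
    (Finset.range n.toNat ×ˢ Finset.range n.toNat).powerset).subset ?_
  rintro _ ⟨lam, hlam, rfl⟩
  have hl : lam.card = n.toNat := by
    have : (lam.card : ℤ) = n := hlam
    omega
  have := key lam
  rw [hl] at this
  exact Finset.mem_coe.2 (Finset.mem_powerset.2 this)

/-- The finite set of all partitions `λ ⊢ n`; it is empty for `n < 0`. -/
def partitions (n : ℤ) : Finset YoungDiagram :=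
  (finite_partitions n).toFinset

/-- `ν → μ`: `ν ≤ μ` and `μ - ν` is a horizontal strip, that is, it has at most one cell in every
column. -/
def HorizontalStrip (ν μ : YoungDiagram) : Prop :=
  ν ≤ μ ∧ ∀ j, μ.colLen j ≤ ν.colLen j + 1

/-- `N^λ_{μ,r}`: the number of partitions `ν` with `ν → μ`, `ν → λ` and
`|μ - ν| + |λ - ν| = r`. -/
def pieriNumber (lam μ : YoungDiagram) (r : ℕ) : ℕ :=
  {ν : YoungDiagram | HorizontalStrip ν μ ∧ HorizontalStrip ν lam ∧
    (μ.cells \ ν.cells).card + (lam.cells \ ν.cells).card = r}.ncard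

end ISchur

end

noncomputable section

namespace ISchur

open Polynomial

/-! Let `e_j` be the shift raising coordinate `j`, and `u_j = e_j + θ e_j⁻¹`. Since `e_j (1 - θ
L_ij)(1 - R_ij) = u_j - u_i`, the defining operator times the shift by `δ = (0, 1, …, l - 1)` is the
Vandermonde determinant in the `u_j` (`giambelliOp_mul_single_staircase`). As `h_α` ignores the
order of its indices, `alt n = s_{n + δ}` is alternating in `n` (`sVec_swap`).

To multiply `s_α` by `h_r`, append `r` as a last coordinate. The factors of the longer operator that
involve this coordinate can be inverted by geometric series, up to operators lowering it by more
than `r`, and these kill `h_{(α, r)}`. This gives an unrestricted expansion (`sVec_mul_hNat`): from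
`m = α - δ` go down by `a` boxes to `k`, with weight `θ ^ a`, then up by `r - a` boxes from `(k,
-l)` to `n`, and sum `alt n`.

Sign-reversing swaps of adjacent entries remove every `k` with `k_i ≤ m_{i+1}`, then every `n` with
`n_{i+1} ≥ k_i` (`sum_below_eq`, `sum_above_eq`, combined in `alt_mul_hNat`). The surviving
interlacing inequalities say exactly that `ν → μ` and `ν → λ` when `m`, `k`, `n` are the vectors
with entries `μ_i - i`, `ν_i - i`, `λ_i - i`. Counting the survivors produces `N^λ_{μ,r}`
(`sum_partitions_pieriNumber`). -/

/-! ### Shift operators acting on `h_α` -/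

theorem actOnH_single {l : ℕ} (γ : Fin l → ℤ) (c : ℚ[X]) (α : Fin l → ℤ) :
    actOnH (AddMonoidAlgebra.single γ c) α = c • hVec (α + γ) := by
  simp [actOnH]

/-- The action of operators on `h_α`, as a linear map in the operator. -/
def hEval {l : ℕ} (α : Fin l → ℤ) : ShiftOp l →ₗ[ℚ[X]] SymFun where
  toFun D := actOnH D α
  map_add' D D' := by
    simp only [actOnH, AddMonoidAlgebra.coeff_add]
    exact Finsupp.sum_add_index' (by simp) (by intros; rw [add_smul])
  map_smul' c D := by
    simp only [actOnH, AddMonoidAlgebra.coeff_smul, RingHom.id_apply]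
    rw [Finsupp.sum_smul_index' (by simp), Finsupp.smul_sum]
    simp [smul_smul]

theorem hEval_single {l : ℕ} (γ : Fin l → ℤ) (c : ℚ[X]) (α : Fin l → ℤ) :
    hEval α (AddMonoidAlgebra.single γ c) = c • hVec (α + γ) :=
  actOnH_single γ c α

/-- Operators act on the index before `h` is evaluated, so a monomial factor can be absorbed into
the index. This is how shifts and expansions of operators become identities between the `s_α`. -/
theorem hEval_mul_single {l : ℕ} (D : ShiftOp l) (γ : Fin l → ℤ) (c : ℚ[X]) (α : Fin l → ℤ) :
    hEval α (D * AddMonoidAlgebra.single γ c) = c • hEval (α + γ) D := by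
  induction D using AddMonoidAlgebra.induction_linear with
  | zero => simp
  | add f g hf hg => rw [add_mul, map_add, map_add, hf, hg, smul_add]
  | single m r =>
    rw [AddMonoidAlgebra.single_mul_single, hEval_single, hEval_single, smul_smul, mul_comm r c,
      add_assoc, add_comm γ m]

/-! ### Permuting the coordinates -/

/-- The permutation of coordinates on operators. -/
def permOp {l : ℕ} (σ : Equiv.Perm (Fin l)) : ShiftOp l →+* ShiftOp l :=
  AddMonoidAlgebra.mapDomainRingHom ℚ[X]
    (LinearMap.funLeft ℤ ℤ σ : (Fin l → ℤ) →ₗ[ℤ] (Fin l → ℤ)).toAddMonoidHom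

theorem permOp_single {l : ℕ} (σ : Equiv.Perm (Fin l)) (γ : Fin l → ℤ) (c : ℚ[X]) :
    permOp σ (AddMonoidAlgebra.single γ c) = AddMonoidAlgebra.single (γ ∘ σ) c := by
  simp [permOp]
  rfl

theorem hVec_comp_perm {l : ℕ} (σ : Equiv.Perm (Fin l)) (α : Fin l → ℤ) :
    hVec (α ∘ σ) = hVec α :=
  Equiv.prod_comp σ fun i => hInt (α i)

theorem hEval_permOp {l : ℕ} (σ : Equiv.Perm (Fin l)) (α : Fin l → ℤ) (D : ShiftOp l) :
    hEval (α ∘ σ) (permOp σ D) = hEval α D := by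
  induction D using AddMonoidAlgebra.induction_linear with
  | zero => simp
  | add f g hf hg => rw [map_add, map_add, map_add, hf, hg]
  | single m r =>
    rw [permOp_single, hEval_single, hEval_single, ← hVec_comp_perm σ (α + m)]
    rfl

/-! ### The staircase shift and the Vandermonde form of the operator -/

/-- The vector `(0, 1, …, l - 1)`. -/
def staircase (l : ℕ) : Fin l → ℤ := fun j => (j : ℤ)

/-- The operator `e_j + θ e_j⁻¹`, where `e_j` raises the `j`-th coordinate by one. -/
def uOp {l : ℕ} (j : Fin l) : ShiftOp l :=
  AddMonoidAlgebra.single (Pi.single j 1) 1 + AddMonoidAlgebra.single (-Pi.single j 1) theta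

theorem permOp_uOp {l : ℕ} (σ : Equiv.Perm (Fin l)) (j : Fin l) :
    permOp σ (uOp j) = uOp (σ⁻¹ j) := by
  have h : (Pi.single j 1 : Fin l → ℤ) ∘ σ = Pi.single (σ⁻¹ j) 1 := by
    funext i
    simp only [Function.comp, Pi.single_apply, Equiv.Perm.eq_inv_iff_eq]
  have h' : (-Pi.single j 1 : Fin l → ℤ) ∘ σ = -Pi.single (σ⁻¹ j) 1 := by
    rw [← h]; rfl
  rw [uOp, map_add, permOp_single, permOp_single, h, h', uOp]

/-- The Vandermonde determinant in the operators `uOp j`. -/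
def vandermondeOp (l : ℕ) : ShiftOp l := (Matrix.vandermonde (uOp (l := l))).det

theorem permOp_vandermondeOp {l : ℕ} (σ : Equiv.Perm (Fin l)) :
    permOp σ (vandermondeOp l) = (Equiv.Perm.sign σ : ℤ) • vandermondeOp l := by
  rw [vandermondeOp, RingHom.map_det]
  have : (permOp σ).mapMatrix (Matrix.vandermonde (uOp (l := l))) =
      (Matrix.vandermonde (uOp (l := l))).submatrix (σ⁻¹ : Equiv.Perm (Fin l)) id := by
    ext1 i j
    simp [Matrix.vandermonde_apply, permOp_uOp]
  rw [this, Matrix.det_permute, Equiv.Perm.sign_inv, zsmul_eq_mul]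

/-- The product is `(e_j - θ e_i⁻¹)(1 - e_i e_j⁻¹)`; its expansion separates the variables, which is
what makes a Vandermonde determinant appear. -/
theorem single_mul_one_sub_mul {l : ℕ} (i j : Fin l) :
    AddMonoidAlgebra.single (Pi.single j 1) 1 *
      ((1 - theta • lowering i j) * (1 - raising i j)) = uOp j - uOp i := by
  have e (v w : Fin l → ℤ) (c d : ℚ[X]) (h : v = w) (h' : c = d) :
    AddMonoidAlgebra.single v c = AddMonoidAlgebra.single w d := by rw [h, h']
  simp only [lowering, raising, uOp, AddMonoidAlgebra.smul_single, sub_mul, mul_sub, one_mul,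
    mul_one, AddMonoidAlgebra.single_mul_single, smul_eq_mul]
  have h1 : (AddMonoidAlgebra.single (Pi.single j 1 + (-Pi.single i 1 - Pi.single j 1)) theta :
      ShiftOp l) = AddMonoidAlgebra.single (-Pi.single i 1) theta := e _ _ _ _ (by abel) rfl
  have h2 : (AddMonoidAlgebra.single (Pi.single j 1 + (Pi.single i 1 - Pi.single j 1)) 1 :
      ShiftOp l) = AddMonoidAlgebra.single (Pi.single i 1) 1 := e _ _ _ _ (by abel) rfl
  have h3 : (AddMonoidAlgebra.single (Pi.single j 1 + (-Pi.single i 1 - Pi.single j 1 +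
      (Pi.single i 1 - Pi.single j 1))) theta :
      ShiftOp l) = AddMonoidAlgebra.single (-Pi.single j 1) theta := e _ _ _ _ (by abel) rfl
  rw [h1, h2, h3]
  abel

theorem giambelliOp_eq {l : ℕ} : giambelliOp l = ∏ i : Fin l, ∏ j : Fin l,
    if i < j then (1 - theta • lowering i j) * (1 - raising i j) else 1 := by
  rw [giambelliOp, Finset.prod_filter, Fintype.prod_prod_type]

/-- One factor `e_j` is distributed to each pair `i < j`, so `e_j` occurs `j` times in total. -/
theorem single_staircase (l : ℕ) : (AddMonoidAlgebra.single (staircase l) 1 : ShiftOp l) =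
    ∏ i : Fin l, ∏ j : Fin l, if i < j then AddMonoidAlgebra.single (Pi.single j 1) 1 else 1 := by
  rw [Finset.prod_comm]
  have h (j : Fin l) : (∏ i : Fin l, if i < j then
      (AddMonoidAlgebra.single (Pi.single j 1) 1 : ShiftOp l) else 1) =
      AddMonoidAlgebra.single (Pi.single j (j : ℤ)) 1 := by
    rw [← Finset.prod_filter, Finset.prod_const, AddMonoidAlgebra.single_pow]
    have : (Finset.univ.filter fun i : Fin l => i < j).card = j := by
      rw [Finset.filter_gt_eq_Iio, Fin.card_Iio]
    rw [this, one_pow, ← Pi.single_smul]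
    simp
  have hs : staircase l = ∑ j : Fin l, Pi.single j (j : ℤ) :=
    (Finset.univ_sum_single (staircase l)).symm
  simp_rw [h]
  rw [hs]
  generalize (Finset.univ : Finset (Fin l)) = s
  induction s using Finset.cons_induction with
  | empty => rfl
  | cons a s ha ih => rw [Finset.sum_cons, Finset.prod_cons, ← ih,
      AddMonoidAlgebra.single_mul_single, one_mul]

theorem giambelliOp_mul_single_staircase (l : ℕ) :
    giambelliOp l * AddMonoidAlgebra.single (staircase l) 1 = vandermondeOp l := by
  rw [vandermondeOp, Matrix.det_vandermonde, giambelliOp_eq, single_staircase, mul_comm,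
    ← Finset.prod_mul_distrib]
  refine Finset.prod_congr rfl fun i _ => ?_
  rw [← Finset.prod_mul_distrib, ← Finset.filter_lt_eq_Ioi, Finset.prod_filter]
  refine Finset.prod_congr rfl fun j _ => ?_
  split_ifs
  · exact single_mul_one_sub_mul i j
  · exact one_mul 1

/-! ### The functions `s_α` for integer vectors -/

/-- `s_α = ∏_{i < j} (1 - θ L_{ij}) (1 - R_{ij}) h_α` for an integer vector `α`. -/
def sVec {l : ℕ} (α : Fin l → ℤ) : SymFun := hEval α (giambelliOp l)

theorem sVec_add_staircase {l : ℕ} (β : Fin l → ℤ) :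
    sVec (β + staircase l) = hEval β (vandermondeOp l) := by
  rw [← giambelliOp_mul_single_staircase, hEval_mul_single, one_smul, sVec]

theorem sVec_perm {l : ℕ} (σ : Equiv.Perm (Fin l)) (β : Fin l → ℤ) :
    sVec (β ∘ σ + staircase l) = (Equiv.Perm.sign σ : ℤ) • sVec (β + staircase l) := by
  -- Permuting operator and index together changes nothing, and permuting the Vandermonde operator
  -- alone costs the sign; the two signs on the right then multiply to one.
  rw [sVec_add_staircase, sVec_add_staircase, ← hEval_permOp σ β, permOp_vandermondeOp, map_zsmul,
    smul_smul]
  rcases Int.units_eq_one_or (Equiv.Perm.sign σ) with h | h <;> simp [h]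

theorem sVec_swap {l : ℕ} {i j : Fin l} (hij : i ≠ j) (β : Fin l → ℤ) :
    sVec (β ∘ Equiv.swap i j + staircase l) = -sVec (β + staircase l) := by
  rw [sVec_perm, Equiv.Perm.sign_swap hij]
  simp

/-! ### Splitting off the last coordinate -/

/-- The map `γ ↦ (γ, 0)`. -/
def snocZero (l : ℕ) : (Fin l → ℤ) →+ (Fin (l + 1) → ℤ) where
  toFun γ := Fin.snoc γ 0
  map_zero' := by
    funext i
    refine Fin.lastCases ?_ (fun i => ?_) i <;> simp
  map_add' γ δ := by
    funext i
    refine Fin.lastCases ?_ (fun i => ?_) i <;> simp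

/-- Operators on vectors of length `l`, acting on the first `l` coordinates. -/
def extOp (l : ℕ) : ShiftOp l →+* ShiftOp (l + 1) :=
  AddMonoidAlgebra.mapDomainRingHom ℚ[X] (snocZero l)

theorem extOp_single {l : ℕ} (γ : Fin l → ℤ) (c : ℚ[X]) :
    extOp l (AddMonoidAlgebra.single γ c) = AddMonoidAlgebra.single (Fin.snoc γ 0) c := by
  simp [extOp]
  rfl

theorem hVec_snoc {l : ℕ} (α : Fin l → ℤ) (a : ℤ) :
    hVec (Fin.snoc α a : Fin (l + 1) → ℤ) = hVec α * hInt a := by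
  simp [hVec, Fin.prod_univ_castSucc]

theorem snoc_add_snoc {l : ℕ} (α γ : Fin l → ℤ) (a b : ℤ) :
    (Fin.snoc α a + Fin.snoc γ b : Fin (l + 1) → ℤ) = Fin.snoc (α + γ) (a + b) := by
  funext i
  refine Fin.lastCases ?_ (fun i => ?_) i <;> simp

theorem hEval_extOp {l : ℕ} (α : Fin l → ℤ) (a : ℤ) (D : ShiftOp l) :
    hEval (Fin.snoc α a) (extOp l D) = hEval α D * hInt a := by
  induction D using AddMonoidAlgebra.induction_linear with
  | zero => simp
  | add f g hf hg => rw [map_add, map_add, map_add, hf, hg, add_mul]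
  | single m r =>
    rw [extOp_single, hEval_single, hEval_single, snoc_add_snoc, hVec_snoc, add_zero,
      smul_mul_assoc]

/-- Operators which lower the last coordinate by at least `d`. -/
def lowerLast (l : ℕ) (d : ℤ) : Submodule ℚ[X] (ShiftOp (l + 1)) :=
  Submodule.span ℚ[X] ((fun γ => AddMonoidAlgebra.single γ 1) '' {γ | γ (Fin.last l) ≤ -d})

theorem single_mem_lowerLast {l : ℕ} {d : ℤ} {γ : Fin (l + 1) → ℤ} (c : ℚ[X])
    (h : γ (Fin.last l) ≤ -d) : AddMonoidAlgebra.single γ c ∈ lowerLast l d := by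
  have : (AddMonoidAlgebra.single γ c : ShiftOp (l + 1)) =
      c • AddMonoidAlgebra.single γ 1 := by simp
  rw [this]
  exact Submodule.smul_mem _ _ (Submodule.subset_span ⟨γ, h, rfl⟩)

theorem mul_mem_lowerLast {l : ℕ} {d e : ℤ} {D D' : ShiftOp (l + 1)}
    (hD : D ∈ lowerLast l d) (hD' : D' ∈ lowerLast l e) : D * D' ∈ lowerLast l (d + e) := by
  have := Submodule.mul_mem_mul hD hD'
  rw [lowerLast, lowerLast, Submodule.span_mul_span] at this
  refine Submodule.span_le.2 ?_ this
  rintro _ ⟨_, ⟨γ, hγ, rfl⟩, _, ⟨δ, hδ, rfl⟩, rfl⟩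
  simp only [AddMonoidAlgebra.single_mul_single, Set.mem_ofPred_eq] at *
  exact single_mem_lowerLast _ (by simp only [Pi.add_apply]; omega)

theorem lowerLast_anti {l : ℕ} {d e : ℤ} (h : d ≤ e) : lowerLast l e ≤ lowerLast l d :=
  Submodule.span_mono (Set.image_mono fun γ (hγ : γ _ ≤ _) => show γ _ ≤ _ by omega)

theorem one_mem_lowerLast (l : ℕ) : (1 : ShiftOp (l + 1)) ∈ lowerLast l 0 :=
  single_mem_lowerLast 1 (by simp)

theorem extOp_mem_lowerLast {l : ℕ} (D : ShiftOp l) : extOp l D ∈ lowerLast l 0 := by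
  induction D using AddMonoidAlgebra.induction_linear with
  | zero => simp
  | add f g hf hg => rw [map_add]; exact add_mem hf hg
  | single m r =>
    rw [extOp_single]
    exact single_mem_lowerLast _ (by simp)

theorem hInt_of_neg {a : ℤ} (h : a < 0) : hInt a = 0 := if_neg (not_le.2 h)

theorem hInt_natCast (n : ℕ) : hInt n = hNat n := by simp [hInt]

/-- Every term acquires a factor `h_a` with `a < 0`. This lets `lowerLast l d` serve as an error
term in the truncations below. -/
theorem hEval_eq_zero_of_mem_lowerLast {l : ℕ} {d : ℤ} {D : ShiftOp (l + 1)}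
    (hD : D ∈ lowerLast l d) {α : Fin (l + 1) → ℤ} (hα : α (Fin.last l) < d) :
    hEval α D = 0 := by
  have : lowerLast l d ≤ LinearMap.ker (hEval α) := by
    refine Submodule.span_le.2 ?_
    rintro _ ⟨γ, hγ, rfl⟩
    rw [SetLike.mem_coe, LinearMap.mem_ker, hEval_single, one_smul]
    exact Finset.prod_eq_zero (Finset.mem_univ (Fin.last l)) (hInt_of_neg (by
      simp only [Set.mem_ofPred_eq, Pi.add_apply] at *; omega))
  exact this hD

theorem mul_sub_one_mem_lowerLast {l : ℕ} {d : ℤ} (hd : 0 ≤ d) {D D' : ShiftOp (l + 1)}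
    (hD : D - 1 ∈ lowerLast l d) (hD' : D' - 1 ∈ lowerLast l d) : D * D' - 1 ∈ lowerLast l d := by
  rw [show D * D' - 1 = (D - 1) * (D' - 1) + ((D - 1) + (D' - 1)) by ring]
  exact add_mem (lowerLast_anti (by omega) (mul_mem_lowerLast hD hD')) (add_mem hD hD')

theorem prod_sub_one_mem_lowerLast {l : ℕ} {d : ℤ} (hd : 0 ≤ d) {ι : Type*} (s : Finset ι)
    (f : ι → ShiftOp (l + 1)) (hf : ∀ i ∈ s, f i - 1 ∈ lowerLast l d) :
    ∏ i ∈ s, f i - 1 ∈ lowerLast l d := by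
  induction s using Finset.cons_induction with
  | empty => simp
  | cons a s ha ih =>
    rw [Finset.prod_cons]
    exact mul_sub_one_mem_lowerLast hd (hf a (Finset.mem_cons_self a s))
      (ih fun i hi => hf i (Finset.mem_cons_of_mem hi))

/-- The factors of the operator which involve the last coordinate. -/
def lastFactor (l : ℕ) : ShiftOp (l + 1) :=
  ∏ i : Fin l, (1 - theta • lowering i.castSucc (Fin.last l)) *
    (1 - raising i.castSucc (Fin.last l))

theorem snoc_single_zero {l : ℕ} (i : Fin l) (a : ℤ) :
    (Fin.snoc (Pi.single i a : Fin l → ℤ) 0 : Fin (l + 1) → ℤ) = Pi.single i.castSucc a := by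
  funext j
  refine Fin.lastCases ?_ (fun j => ?_) j
  · simp [(Fin.castSucc_lt_last i).ne']
  · simp [Pi.single_apply]

theorem extOp_raising {l : ℕ} (i j : Fin l) :
    extOp l (raising i j) = raising i.castSucc j.castSucc := by
  rw [raising, extOp_single, raising, ← snoc_single_zero, ← snoc_single_zero]
  exact congrArg (AddMonoidAlgebra.single · 1) ((snocZero l).map_sub _ _)

theorem extOp_lowering {l : ℕ} (i j : Fin l) :
    extOp l (lowering i j) = lowering i.castSucc j.castSucc := by
  rw [lowering, extOp_single, lowering, ← snoc_single_zero, ← snoc_single_zero]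
  refine congrArg (AddMonoidAlgebra.single · 1) (((snocZero l).map_sub _ _).trans ?_)
  rw [map_neg]
  rfl

theorem extOp_smul {l : ℕ} (c : ℚ[X]) (D : ShiftOp l) : extOp l (c • D) = c • extOp l D := by
  induction D using AddMonoidAlgebra.induction_linear with
  | zero => simp
  | add f g hf hg => rw [smul_add, map_add, map_add, hf, hg, smul_add]
  | single m r => simp [extOp_single]

theorem giambelliOp_succ (l : ℕ) :
    giambelliOp (l + 1) = extOp l (giambelliOp l) * lastFactor l := by
  rw [giambelliOp_eq, giambelliOp_eq, Fin.prod_univ_castSucc]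
  have h0 : (∏ j : Fin (l + 1), if Fin.last l < j then
      (1 - theta • lowering (Fin.last l) j) * (1 - raising (Fin.last l) j) else 1) = 1 :=
    Finset.prod_eq_one fun j _ => if_neg (Fin.le_last j).not_gt
  simp_rw [h0, mul_one, Fin.prod_univ_castSucc, Finset.prod_mul_distrib, map_prod]
  rw [lastFactor]
  congr 1
  · refine Finset.prod_congr rfl fun i _ => Finset.prod_congr rfl fun j _ => ?_
    simp only [Fin.castSucc_lt_castSucc_iff]
    split_ifs
    · simp [extOp_raising, extOp_lowering, extOp_smul]
    · simp
  · refine Finset.prod_congr rfl fun i _ => ?_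
    rw [if_pos (Fin.castSucc_lt_last i)]

theorem raising_castSucc_last {l : ℕ} (i : Fin l) :
    raising i.castSucc (Fin.last l) =
      AddMonoidAlgebra.single (Fin.snoc (Pi.single i 1 : Fin l → ℤ) (-1)) 1 := by
  rw [raising]
  congr 1
  funext j
  refine Fin.lastCases ?_ (fun j => ?_) j
  · simp [(Fin.castSucc_lt_last i).ne']
  · simp [Pi.single_apply, (Fin.castSucc_lt_last j).ne]

theorem smul_lowering_castSucc_last {l : ℕ} (i : Fin l) :
    theta • lowering i.castSucc (Fin.last l) =
      AddMonoidAlgebra.single (Fin.snoc (-Pi.single i 1 : Fin l → ℤ) (-1)) theta := by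
  rw [lowering, AddMonoidAlgebra.smul_single, smul_eq_mul, mul_one]
  congr 1
  funext j
  refine Fin.lastCases ?_ (fun j => ?_) j
  · simp [(Fin.castSucc_lt_last i).ne']
  · simp [Pi.single_apply, (Fin.castSucc_lt_last j).ne]

theorem lastFactor_sub_one_mem (l : ℕ) : lastFactor l - 1 ∈ lowerLast l 1 := by
  refine prod_sub_one_mem_lowerLast zero_le_one _ _ fun i _ =>
    mul_sub_one_mem_lowerLast zero_le_one ?_ ?_
  · rw [sub_sub_cancel_left, smul_lowering_castSucc_last]
    exact neg_mem (single_mem_lowerLast _ (by simp))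
  · rw [sub_sub_cancel_left, raising_castSucc_last]
    exact neg_mem (single_mem_lowerLast _ (by simp))

theorem lastFactor_mem (l : ℕ) : lastFactor l ∈ lowerLast l 0 := by
  rw [← sub_add_cancel (lastFactor l) 1]
  exact add_mem (lowerLast_anti zero_le_one (lastFactor_sub_one_mem l)) (one_mem_lowerLast l)

theorem giambelliOp_succ_mem (l : ℕ) : giambelliOp (l + 1) ∈ lowerLast l 0 := by
  rw [giambelliOp_succ, ← add_zero (0 : ℤ)]
  exact mul_mem_lowerLast (extOp_mem_lowerLast _) (lastFactor_mem l)

/-- No term of the operator raises the last coordinate, since that coordinate is never the smaller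
index of a pair. -/
theorem sVec_eq_zero_of_last_neg {l : ℕ} {α : Fin (l + 1) → ℤ} (h : α (Fin.last l) < 0) :
    sVec α = 0 := by
  rw [sVec]
  exact hEval_eq_zero_of_mem_lowerLast (giambelliOp_succ_mem l) h

theorem hInt_zero : hInt 0 = 1 := by
  have : hInt 0 = hNat 0 := hInt_natCast 0
  rw [this]
  apply Subtype.ext
  change completeHomogeneous 0 = 1
  refine MvPowerSeries.ext fun m => ?_
  rw [MvPowerSeries.coeff_one]
  change (if m.degree = 0 then (1 : ℚ[X]) else 0) = _
  simp only [Finsupp.degree_eq_zero_iff]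

/-- Beyond its constant term `1`, `lastFactor` strictly lowers the final `0`, so only `h_0 = 1`
remains. Hence partitions may be padded with zeros. -/
theorem sVec_snoc_zero {l : ℕ} (α : Fin l → ℤ) :
    sVec (Fin.snoc α 0 : Fin (l + 1) → ℤ) = sVec α := by
  have h : giambelliOp (l + 1) = extOp l (giambelliOp l) +
      extOp l (giambelliOp l) * (lastFactor l - 1) := by
    rw [giambelliOp_succ]; ring
  rw [sVec, h, map_add, hEval_extOp, hInt_zero, mul_one, hEval_eq_zero_of_mem_lowerLast
    (mul_mem_lowerLast (extOp_mem_lowerLast _) (lastFactor_sub_one_mem l)) (by simp), add_zero, sVec]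

/-! ### Expansion of `s_α h_r` -/

theorem prod_single {l : ℕ} {ι : Type*} (s : Finset ι) (γ : ι → Fin l → ℤ) (c : ι → ℚ[X]) :
    ∏ i ∈ s, (AddMonoidAlgebra.single (γ i) (c i) : ShiftOp l) =
      AddMonoidAlgebra.single (∑ i ∈ s, γ i) (∏ i ∈ s, c i) := by
  induction s using Finset.cons_induction with
  | empty => rfl
  | cons a s ha ih => rw [Finset.prod_cons, Finset.prod_cons, Finset.sum_cons, ih,
      AddMonoidAlgebra.single_mul_single]

theorem sum_snoc_single {l : ℕ} (ε : ℤ) (q : Fin l → ℕ) :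
    ∑ i, q i • (Fin.snoc (Pi.single i ε : Fin l → ℤ) (-1) : Fin (l + 1) → ℤ) =
      Fin.snoc (fun i => ε * q i) (-∑ i, (q i : ℤ)) := by
  funext j
  rw [Finset.sum_apply]
  refine Fin.lastCases ?_ (fun j => ?_) j
  · simp
  · simp only [Pi.smul_apply, Fin.snoc_castSucc, nsmul_eq_mul]
    rw [Finset.sum_eq_single j]
    · simp [mul_comm]
    · intro b _ hb
      simp [hb.symm]
    · simp

theorem prod_geom_sum_single {l : ℕ} (ε : ℤ) (c : ℚ[X]) (r : ℕ) :
    ∏ i : Fin l, ∑ n ∈ Finset.range (r + 1), (AddMonoidAlgebra.single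
        (Fin.snoc (Pi.single i ε : Fin l → ℤ) (-1) : Fin (l + 1) → ℤ) c : ShiftOp (l + 1)) ^ n =
      ∑ q ∈ Fintype.piFinset fun _ : Fin l => Finset.range (r + 1), AddMonoidAlgebra.single
        (Fin.snoc (fun i => ε * q i) (-∑ i, (q i : ℤ)) : Fin (l + 1) → ℤ) (c ^ ∑ i, q i) := by
  rw [Finset.prod_univ_sum]
  refine Finset.sum_congr rfl fun q _ => ?_
  simp_rw [AddMonoidAlgebra.single_pow]
  rw [prod_single, sum_snoc_single, Finset.prod_pow_eq_pow_sum]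

/-- The truncated inverse of `lastFactor`. -/
def lastInverse (l r : ℕ) : ShiftOp (l + 1) :=
  (∏ i : Fin l, ∑ n ∈ Finset.range (r + 1), (AddMonoidAlgebra.single
    (Fin.snoc (Pi.single i (-1) : Fin l → ℤ) (-1) : Fin (l + 1) → ℤ) theta) ^ n) *
  ∏ i : Fin l, ∑ n ∈ Finset.range (r + 1), (AddMonoidAlgebra.single
    (Fin.snoc (Pi.single i 1 : Fin l → ℤ) (-1) : Fin (l + 1) → ℤ) 1) ^ n

theorem geom_sum_single_sub_one_mem {l : ℕ} (ε : Fin l → ℤ) (c : ℚ[X]) (r : ℕ) :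
    (1 - AddMonoidAlgebra.single (Fin.snoc ε (-1) : Fin (l + 1) → ℤ) c) *
      (∑ n ∈ Finset.range (r + 1),
        (AddMonoidAlgebra.single (Fin.snoc ε (-1) : Fin (l + 1) → ℤ) c) ^ n) - 1 ∈
      lowerLast l (r + 1) := by
  rw [mul_neg_geom_sum, sub_sub_cancel_left, AddMonoidAlgebra.single_pow]
  exact neg_mem (single_mem_lowerLast _ (by simp))

theorem lastFactor_mul_lastInverse_sub_one_mem (l r : ℕ) :
    lastFactor l * lastInverse l r - 1 ∈ lowerLast l (r + 1) := by
  rw [lastFactor, lastInverse, Finset.prod_mul_distrib, mul_mul_mul_comm,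
    ← Finset.prod_mul_distrib, ← Finset.prod_mul_distrib]
  have hr : (0 : ℤ) ≤ r + 1 := by omega
  refine mul_sub_one_mem_lowerLast hr (prod_sub_one_mem_lowerLast hr _ _ fun i _ => ?_)
    (prod_sub_one_mem_lowerLast hr _ _ fun i _ => ?_)
  · rw [smul_lowering_castSucc_last, ← Pi.single_neg]
    exact geom_sum_single_sub_one_mem _ _ _
  · rw [raising_castSucc_last]
    exact geom_sum_single_sub_one_mem _ _ _

theorem sVec_mul_hNat_aux {l : ℕ} (α : Fin l → ℤ) (r : ℕ) :
    sVec α * hNat r = hEval (Fin.snoc α (r : ℤ)) (giambelliOp (l + 1) * lastInverse l r) := by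
  -- The second summand lowers the last coordinate by at least `r + 1`, hence vanishes on an index
  -- ending in `r`; the first gives `s_α h_r`.
  have h : giambelliOp (l + 1) * lastInverse l r = extOp l (giambelliOp l) +
      extOp l (giambelliOp l) * (lastFactor l * lastInverse l r - 1) := by
    rw [giambelliOp_succ]; ring
  rw [h, map_add, hEval_extOp, hInt_natCast, hEval_eq_zero_of_mem_lowerLast
    (mul_mem_lowerLast (extOp_mem_lowerLast _) (lastFactor_mul_lastInverse_sub_one_mem l r))
    (by simp), add_zero, sVec]

theorem sVec_mul_hNat_box {l : ℕ} (α : Fin l → ℤ) (r : ℕ) :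
    sVec α * hNat r = ∑ q ∈ Fintype.piFinset fun _ : Fin l => Finset.range (r + 1),
      theta ^ (∑ i, q i) • ∑ p ∈ Fintype.piFinset fun _ : Fin l => Finset.range (r + 1),
        sVec (Fin.snoc (fun i => α i - q i + p i) (r - ∑ i, (q i : ℤ) - ∑ i, (p i : ℤ)) :
          Fin (l + 1) → ℤ) := by
  rw [sVec_mul_hNat_aux, lastInverse, prod_geom_sum_single, prod_geom_sum_single,
    Finset.sum_mul, Finset.mul_sum, map_sum]
  refine Finset.sum_congr rfl fun q _ => ?_
  rw [Finset.mul_sum, Finset.mul_sum, map_sum, Finset.smul_sum]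
  refine Finset.sum_congr rfl fun p _ => ?_
  rw [AddMonoidAlgebra.single_mul_single, hEval_mul_single, sVec, one_pow, mul_one]
  congr 3
  rw [snoc_add_snoc, snoc_add_snoc]
  congr 1
  · funext i
    simp only [Pi.add_apply]
    ring
  · ring

/-- The vectors `k ≤ m` with `∑ (m_i - k_i) = a`. -/
def below {ι : Type*} [Fintype ι] [DecidableEq ι] (m : ι → ℤ) (a : ℕ) : Finset (ι → ℤ) :=
  (Finset.piAntidiag Finset.univ a).image fun q i => m i - (q i : ℤ)

/-- The vectors `n ≥ k` with `∑ (n_i - k_i) = c`. -/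
def above {ι : Type*} [Fintype ι] [DecidableEq ι] (k : ι → ℤ) (c : ℕ) : Finset (ι → ℤ) :=
  (Finset.piAntidiag Finset.univ c).image fun p i => k i + (p i : ℤ)

section

variable {ι : Type*} [Fintype ι] [DecidableEq ι]

theorem mem_below {m k : ι → ℤ} {a : ℕ} :
    k ∈ below m a ↔ (∀ i, k i ≤ m i) ∧ ∑ i, k i + a = ∑ i, m i := by
  simp only [below, Finset.mem_image, Finset.mem_piAntidiag, Finset.mem_univ, implies_true,
    and_true]
  constructor
  · rintro ⟨q, rfl, rfl⟩
    refine ⟨fun i => by dsimp only; omega, ?_⟩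
    rw [Finset.sum_sub_distrib]
    push_cast
    ring
  · rintro ⟨h1, h2⟩
    have h3 : ∀ i, ((m i - k i).toNat : ℤ) = m i - k i := fun i =>
      Int.toNat_of_nonneg (by have := h1 i; omega)
    refine ⟨fun i => (m i - k i).toNat, ?_, ?_⟩
    · zify
      rw [Finset.sum_congr rfl fun i _ => h3 i, Finset.sum_sub_distrib]
      omega
    · funext i
      rw [h3]
      ring

theorem mem_above {k n : ι → ℤ} {c : ℕ} :
    n ∈ above k c ↔ (∀ i, k i ≤ n i) ∧ ∑ i, n i = ∑ i, k i + c := by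
  simp only [above, Finset.mem_image, Finset.mem_piAntidiag, Finset.mem_univ, implies_true,
    and_true]
  constructor
  · rintro ⟨q, rfl, rfl⟩
    refine ⟨fun i => by dsimp only; omega, ?_⟩
    rw [Finset.sum_add_distrib]
    push_cast
    ring
  · rintro ⟨h1, h2⟩
    have h3 : ∀ i, ((n i - k i).toNat : ℤ) = n i - k i := fun i =>
      Int.toNat_of_nonneg (by have := h1 i; omega)
    refine ⟨fun i => (n i - k i).toNat, ?_, ?_⟩
    · zify
      rw [Finset.sum_congr rfl fun i _ => h3 i, Finset.sum_sub_distrib]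
      omega
    · funext i
      rw [h3]
      ring

theorem sum_below {A : Type*} [AddCommMonoid A] (m : ι → ℤ) (a : ℕ) (f : (ι → ℤ) → A) :
    ∑ k ∈ below m a, f k = ∑ q ∈ Finset.piAntidiag Finset.univ a, f fun i => m i - (q i : ℤ) :=
  Finset.sum_image fun q _ q' _ h => funext fun i => by have := congrFun h i; simpa using this

theorem sum_above {A : Type*} [AddCommMonoid A] (k : ι → ℤ) (c : ℕ) (f : (ι → ℤ) → A) :
    ∑ n ∈ above k c, f n = ∑ p ∈ Finset.piAntidiag Finset.univ c, f fun i => k i + (p i : ℤ) :=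
  Finset.sum_image fun q _ q' _ h => funext fun i => by have := congrFun h i; simpa using this

theorem sum_box_eq_sum_piAntidiag {A : Type*} [AddCommMonoid A] (r : ℕ) (f : (ι → ℕ) → A)
    (hf : ∀ q, r < ∑ i, q i → f q = 0) :
    ∑ q ∈ Fintype.piFinset fun _ : ι => Finset.range (r + 1), f q =
      ∑ a ∈ Finset.range (r + 1), ∑ q ∈ Finset.piAntidiag Finset.univ a, f q := by
  have hle (q : ι → ℕ) (i : ι) : q i ≤ ∑ i, q i :=
    Finset.single_le_sum (f := q) (fun _ _ => Nat.zero_le _) (Finset.mem_univ i)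
  rw [← Finset.sum_filter_of_ne (p := fun q => ∑ i, q i ≤ r)
    (fun q _ h => not_lt.1 fun h' => h (hf q h')),
    ← Finset.sum_fiberwise_of_maps_to (t := Finset.range (r + 1)) (g := fun q => ∑ i, q i)
      (fun q hq => by rw [Finset.mem_filter] at hq; exact Finset.mem_range.2 (by omega))]
  refine Finset.sum_congr rfl fun a ha => Finset.sum_congr ?_ fun _ _ => rfl
  ext q
  simp only [Finset.mem_range, Finset.mem_filter, Fintype.mem_piFinset, Finset.mem_piAntidiag,
    Finset.mem_univ, implies_true, and_true] at *
  refine ⟨fun h => h.2, fun h => ?_⟩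
  have h' : ∑ i, q i = a := h
  refine ⟨⟨fun i => ?_, ?_⟩, h⟩
  · have := hle q i; omega
  · omega

end

/-- A slack variable in the new last slot turns `∑ q_i ≤ c` into an equality. In the expansion of
`s_α h_r` it is the number of boxes placed in the new row. -/
theorem sum_box_eq_sum_piAntidiag_snoc {A : Type*} [AddCommMonoid A] {l r c : ℕ} (hc : c ≤ r)
    (f : (Fin l → ℕ) → A) (hf : ∀ q, c < ∑ i, q i → f q = 0) :
    ∑ q ∈ Fintype.piFinset fun _ : Fin l => Finset.range (r + 1), f q =
      ∑ p ∈ Finset.piAntidiag (Finset.univ : Finset (Fin (l + 1))) c, f (Fin.init p) := by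
  have hle (q : Fin l → ℕ) (i : Fin l) : q i ≤ ∑ i, q i :=
    Finset.single_le_sum (f := q) (fun _ _ => Nat.zero_le _) (Finset.mem_univ i)
  rw [← Finset.sum_filter_of_ne (p := fun q => ∑ i, q i ≤ c)
    (fun q _ h => not_lt.1 fun h' => h (hf q h'))]
  refine Finset.sum_bij' (fun q _ => Fin.snoc q (c - ∑ i, q i)) (fun p _ => Fin.init p)
    ?_ ?_ ?_ ?_ ?_
  · intro q hq
    rw [Finset.mem_filter] at hq
    simp only [Finset.mem_piAntidiag, Finset.mem_univ, implies_true, and_true,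
      Fin.sum_univ_castSucc, Fin.snoc_castSucc, Fin.snoc_last]
    omega
  · intro p hp
    simp only [Finset.mem_piAntidiag, Finset.mem_univ, implies_true, and_true,
      Fin.sum_univ_castSucc] at hp
    have h1 : ∑ i, Fin.init p i ≤ c := by rw [← hp]; exact Nat.le_add_right _ _
    simp only [Finset.mem_filter, Fintype.mem_piFinset, Finset.mem_range]
    refine ⟨fun i => ?_, h1⟩
    have := hle (Fin.init p) i
    omega
  · intro q _
    simp
  · intro p hp
    simp only [Finset.mem_piAntidiag, Finset.mem_univ, implies_true, and_true,
      Fin.sum_univ_castSucc] at hp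
    have : c - ∑ i, Fin.init p i = p (Fin.last l) := by
      simp only [Fin.init]; omega
    simp only [this]
    exact Fin.snoc_init_self p
  · intro q _
    simp

/-- `s_{n + δ}` for the staircase `δ`; it is alternating in `n`. -/
def alt {l : ℕ} (n : Fin l → ℤ) : SymFun := sVec (n + staircase l)

theorem staircase_castSucc {l : ℕ} (i : Fin l) :
    staircase (l + 1) i.castSucc = staircase l i := rfl

theorem staircase_last (l : ℕ) : staircase (l + 1) (Fin.last l) = l := rfl

theorem sVec_mul_hNat {l : ℕ} (m : Fin l → ℤ) (r : ℕ) :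
    alt m * hNat r = ∑ a ∈ Finset.range (r + 1), theta ^ a • ∑ k ∈ below m a,
      ∑ n ∈ above (Fin.snoc k (-(l : ℤ)) : Fin (l + 1) → ℤ) (r - a), alt n := by
  rw [alt, sVec_mul_hNat_box, sum_box_eq_sum_piAntidiag]
  · refine Finset.sum_congr rfl fun a ha => ?_
    rw [sum_below, Finset.smul_sum]
    refine Finset.sum_congr rfl fun q hq => ?_
    simp only [Finset.mem_piAntidiag, Finset.mem_univ, implies_true, and_true,
      Finset.mem_range] at hq ha
    rw [hq, sum_above, sum_box_eq_sum_piAntidiag_snoc (Nat.sub_le r a)]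
    · congr 1
      refine Finset.sum_congr rfl fun p hp => ?_
      simp only [Finset.mem_piAntidiag, Finset.mem_univ, implies_true, and_true,
        Fin.sum_univ_castSucc] at hp
      rw [alt]
      congr 1
      funext i
      refine Fin.lastCases ?_ (fun i => ?_) i
      · simp only [Fin.snoc_last, Pi.add_apply, staircase_last]
        zify [Nat.lt_succ_iff.1 ha] at hp hq
        simp only [Fin.init]
        omega
      · simp only [Fin.snoc_castSucc, Pi.add_apply, staircase_castSucc, Fin.init]
        omega
    · intro p hp
      refine sVec_eq_zero_of_last_neg ?_
      zify [Nat.lt_succ_iff.1 ha] at hp hq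
      rw [Fin.snoc_last]
      omega
  · intro q hq
    refine smul_eq_zero_of_right _ (Finset.sum_eq_zero fun p _ => ?_)
    refine sVec_eq_zero_of_last_neg ?_
    zify at hq
    rw [Fin.snoc_last]
    have : 0 ≤ ∑ i, (p i : ℤ) := Finset.sum_nonneg fun _ _ => by omega
    omega

/-! ### Cancellation -/

theorem eq_zero_of_eq_neg {x : SymFun} (h : x = -x) : x = 0 := by
  have h2 : (2 : ℚ[X]) • x = 0 := by rw [two_smul]; nth_rw 2 [h]; exact add_neg_cancel x
  -- The scalar `2` is invertible because the coefficients contain `ℚ`.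
  have h3 : (C (1 / 2 : ℚ) * 2 : ℚ[X]) = 1 := by
    rw [show (2 : ℚ[X]) = C 2 from rfl, ← C_mul]
    norm_num
  rw [← one_smul ℚ[X] x, ← h3, mul_smul, h2, smul_zero]

theorem sum_eq_zero_of_swap {ι : Type*} [DecidableEq ι] (i j : ι) (s : Finset (ι → ℤ))
    (f : (ι → ℤ) → SymFun) (hs : ∀ k ∈ s, k ∘ Equiv.swap i j ∈ s)
    (hf : ∀ k, f (k ∘ Equiv.swap i j) = -f k) : ∑ k ∈ s, f k = 0 := by
  refine eq_zero_of_eq_neg ?_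
  rw [← Finset.sum_neg_distrib]
  refine Finset.sum_bij' (fun k _ => k ∘ Equiv.swap i j) (fun k _ => k ∘ Equiv.swap i j) hs hs
    ?_ ?_ ?_
  · intro k _; funext x; simp
  · intro k _; funext x; simp
  · intro k _; rw [hf, neg_neg]

theorem sum_comp_swap {ι : Type*} [Fintype ι] [DecidableEq ι] (i j : ι) (k : ι → ℤ) :
    ∑ x, (k ∘ Equiv.swap i j) x = ∑ x, k x :=
  Equiv.sum_comp (Equiv.swap i j) k

theorem sum_filter_eq_of_sum_eq_zero {α : Type*} (s : Finset α) (P Q : α → Prop)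
    [DecidablePred P] [DecidablePred Q] [DecidablePred fun x => P x ∧ ¬ Q x] (f : α → SymFun)
    (h : ∀ x, Q x → P x) (h0 : ∑ x ∈ s with P x ∧ ¬ Q x, f x = 0) :
    ∑ x ∈ s with P x, f x = ∑ x ∈ s with Q x, f x := by
  classical
  have e1 : (s.filter P).filter Q = s.filter Q := by
    ext x
    simp only [Finset.mem_filter]
    exact ⟨fun hx => ⟨hx.1.1, hx.2⟩, fun hx => ⟨⟨hx.1, h x hx.2⟩, hx.2⟩⟩
  have e2 : (s.filter P).filter (fun x => ¬ Q x) = s.filter fun x => P x ∧ ¬ Q x := by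
    ext x
    simp only [Finset.mem_filter, and_assoc]
  rw [← Finset.sum_filter_add_sum_filter_not (s.filter P) Q, e1, e2, h0, add_zero]

theorem comp_swap_apply_of_ne {ι α : Type*} [DecidableEq ι] {i j x : ι} (k : ι → α) (hi : x ≠ i)
    (hj : x ≠ j) : (k ∘ Equiv.swap i j) x = k x :=
  congrArg k (Equiv.swap_apply_of_ne_of_ne hi hj)

theorem comp_swap_apply_left {ι α : Type*} [DecidableEq ι] (i j : ι) (k : ι → α) :
    (k ∘ Equiv.swap i j) i = k j :=
  congrArg k (Equiv.swap_apply_left i j)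

theorem comp_swap_apply_right {ι α : Type*} [DecidableEq ι] (i j : ι) (k : ι → α) :
    (k ∘ Equiv.swap i j) j = k i :=
  congrArg k (Equiv.swap_apply_right i j)

theorem comp_swap_mem_below {ι : Type*} [Fintype ι] [DecidableEq ι] {i j : ι} {m k : ι → ℤ} {a : ℕ}
    (hk : k ∈ below m a) (hi : k j ≤ m i) (hj : k i ≤ m j) :
    k ∘ Equiv.swap i j ∈ below m a := by
  rw [mem_below] at *
  refine ⟨fun x => ?_, by rw [sum_comp_swap, hk.2]⟩
  rcases eq_or_ne x i with rfl | hxi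
  · rwa [comp_swap_apply_left]
  · rcases eq_or_ne x j with rfl | hxj
    · rwa [comp_swap_apply_right]
    · rw [comp_swap_apply_of_ne k hxi hxj]
      exact hk.1 x

theorem comp_swap_mem_above {ι : Type*} [Fintype ι] [DecidableEq ι] {i j : ι} {k n : ι → ℤ} {c : ℕ}
    (hn : n ∈ above k c) (hi : k i ≤ n j) (hj : k j ≤ n i) :
    n ∘ Equiv.swap i j ∈ above k c := by
  rw [mem_above] at *
  refine ⟨fun x => ?_, by rw [sum_comp_swap, hn.2]⟩
  rcases eq_or_ne x i with rfl | hxi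
  · rwa [comp_swap_apply_left]
  · rcases eq_or_ne x j with rfl | hxj
    · rwa [comp_swap_apply_right]
    · rw [comp_swap_apply_of_ne n hxi hxj]
      exact hn.1 x

section

variable {l : ℕ} {f : (Fin l → ℤ) → SymFun}

open scoped Classical in
-- The inequalities are imposed from the first index on. Where the first failure is `k_t ≤ m_{t+1}`,
-- swapping `k_t` and `k_{t+1}` stays below `m` as `m_{t+1} ≤ m_t`, keeps the failure as `k_{t+1} ≤
-- m_{t+1}`, and leaves the earlier inequalities untouched.
theorem sum_below_eq_aux (hf : ∀ i j, i ≠ j → ∀ k, f (k ∘ Equiv.swap i j) = -f k)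
    {m : Fin l → ℤ} (hm : Antitone m) (a t : ℕ) :
    ∑ k ∈ below m a, f k = ∑ k ∈ below m a with
      ∀ i j : Fin l, (i : ℕ) + 1 = j → (i : ℕ) < t → m j < k i, f k := by
  induction t with
  | zero => simp
  | succ t ih =>
    rw [ih]
    refine sum_filter_eq_of_sum_eq_zero _ _ _ _ (fun k h i j hij hi => h i j hij (by omega)) ?_
    by_cases ht : t + 1 < l
    · let i : Fin l := ⟨t, by omega⟩
      let j : Fin l := ⟨t + 1, ht⟩
      have hij : i ≠ j := Fin.ne_of_val_ne (by simp [i, j])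
      have hmij : m j ≤ m i := hm (by simp [i, j])
      have hbad (k : Fin l → ℤ) : (¬ ∀ i j : Fin l, (i : ℕ) + 1 = j → (i : ℕ) < t + 1 → m j < k i) ↔
          ¬ (∀ i j : Fin l, (i : ℕ) + 1 = j → (i : ℕ) < t → m j < k i) ∨ k i ≤ m j := by
        rw [← not_lt, ← not_and_or, not_iff_not]
        refine ⟨fun h => ⟨fun i j hij hi => h i j hij (by omega), h i j rfl (Nat.lt_succ_self t)⟩,
          fun h i' j' hij' hi' => ?_⟩
        rcases Nat.lt_succ_iff_lt_or_eq.1 hi' with h' | h'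
        · exact h.1 i' j' hij' h'
        · obtain rfl : i' = i := Fin.ext h'
          obtain rfl : j' = j := Fin.ext (by rw [← hij', h'])
          exact h.2
      simp only [hbad]
      refine sum_eq_zero_of_swap i j _ f (fun k hk => ?_) (hf i j hij)
      rw [Finset.mem_filter] at *
      obtain ⟨hk, hP, hk'⟩ := hk
      have hki := hk'.resolve_left (not_not_intro hP)
      have hkj := (mem_below.1 hk).1 j
      refine ⟨comp_swap_mem_below hk (hkj.trans hmij) hki, fun i' j' hij' hi' => ?_,
        Or.inr (by rwa [comp_swap_apply_left])⟩
      rw [comp_swap_apply_of_ne k (Fin.ne_of_val_ne (by simp only [i]; omega))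
        (Fin.ne_of_val_ne (by simp only [j]; omega))]
      exact hP i' j' hij' hi'
    · rw [Finset.filter_false_of_mem, Finset.sum_empty]
      rintro k _ ⟨h, h'⟩
      exact h' fun i j hij hi => h i j hij (by omega)

open scoped Classical in
theorem sum_below_eq (hf : ∀ i j, i ≠ j → ∀ k, f (k ∘ Equiv.swap i j) = -f k)
    {m : Fin l → ℤ} (hm : Antitone m) (a : ℕ) :
    ∑ k ∈ below m a, f k = ∑ k ∈ below m a with
      ∀ i j : Fin l, (i : ℕ) + 1 = j → m j < k i, f k := by
  rw [sum_below_eq_aux hf hm a l]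
  simp

open scoped Classical in
-- Here the inequalities constrain the entry of larger index, so they are imposed from the last
-- index backwards: the swap at the current position then leaves those already imposed intact.
theorem sum_above_eq_aux (hf : ∀ i j, i ≠ j → ∀ k, f (k ∘ Equiv.swap i j) = -f k)
    {k : Fin l → ℤ} (hk : Antitone k) (c t : ℕ) :
    ∑ n ∈ above k c, f n = ∑ n ∈ above k c with
      ∀ i j : Fin l, (i : ℕ) + 1 = j → l ≤ (i : ℕ) + t → n j < k i, f n := by
  induction t with
  | zero =>
    rw [Finset.filter_true_of_mem]
    intro n _ i j _ h
    omega
  | succ t ih =>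
    rw [ih]
    refine sum_filter_eq_of_sum_eq_zero _ _ _ _ (fun k h i j hij hi => h i j hij (by omega)) ?_
    -- The new position is `l - (t + 1)`; for `t = 0` it has no successor, and for `t ≥ l` there is
    -- no new position.
    by_cases ht : 1 ≤ t ∧ t + 1 ≤ l
    · let i : Fin l := ⟨l - (t + 1), by omega⟩
      let j : Fin l := ⟨l - t, by omega⟩
      have hij : i ≠ j := Fin.ne_of_val_ne (by simp only [i, j]; omega)
      have hkij : k j ≤ k i := hk (by simp only [i, j, Fin.mk_le_mk]; omega)
      have hbad (n : Fin l → ℤ) :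
          (¬ ∀ i j : Fin l, (i : ℕ) + 1 = j → l ≤ (i : ℕ) + (t + 1) → n j < k i) ↔
          ¬ (∀ i j : Fin l, (i : ℕ) + 1 = j → l ≤ (i : ℕ) + t → n j < k i) ∨ k i ≤ n j := by
        rw [← not_lt, ← not_and_or, not_iff_not]
        refine ⟨fun h => ⟨fun i j hij hi => h i j hij (by omega),
          h i j (by simp only [i, j]; omega) (by simp only [i]; omega)⟩,
          fun h i' j' hij' hi' => ?_⟩
        by_cases h' : l ≤ (i' : ℕ) + t
        · exact h.1 i' j' hij' h'
        · obtain rfl : i' = i := Fin.ext (by simp only [i]; omega)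
          obtain rfl : j' = j := Fin.ext (by simp only [i, j] at *; omega)
          exact h.2
      simp only [hbad]
      refine sum_eq_zero_of_swap i j _ f (fun n hn => ?_) (hf i j hij)
      rw [Finset.mem_filter] at *
      obtain ⟨hn, hP, hn'⟩ := hn
      have hnj := hn'.resolve_left (not_not_intro hP)
      have hni := (mem_above.1 hn).1 i
      refine ⟨comp_swap_mem_above hn hnj (hkij.trans hni), fun i' j' hij' hi' => ?_,
        Or.inr (by rwa [comp_swap_apply_right])⟩
      rw [comp_swap_apply_of_ne n (Fin.ne_of_val_ne (by simp only [i]; omega))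
        (Fin.ne_of_val_ne (by simp only [j]; omega))]
      exact hP i' j' hij' hi'
    · rw [Finset.filter_false_of_mem, Finset.sum_empty]
      rintro n _ ⟨h, h'⟩
      exact h' fun i j hij hi => h i j hij (by omega)

open scoped Classical in
theorem sum_above_eq (hf : ∀ i j, i ≠ j → ∀ k, f (k ∘ Equiv.swap i j) = -f k)
    {k : Fin l → ℤ} (hk : Antitone k) (c : ℕ) :
    ∑ n ∈ above k c, f n = ∑ n ∈ above k c with
      ∀ i j : Fin l, (i : ℕ) + 1 = j → n j < k i, f n := by
  rw [sum_above_eq_aux hf hk c l]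
  simp

theorem sum_above_comp_swap (hf : ∀ i j, i ≠ j → ∀ k, f (k ∘ Equiv.swap i j) = -f k)
    {i j : Fin l} (hij : i ≠ j) (k : Fin l → ℤ) (c : ℕ) :
    ∑ n ∈ above (k ∘ Equiv.swap i j) c, f n = -∑ n ∈ above k c, f n := by
  rw [← Finset.sum_neg_distrib]
  have key (k n : Fin l → ℤ) (h : n ∈ above k c) :
      n ∘ Equiv.swap i j ∈ above (k ∘ Equiv.swap i j) c := by
    rw [mem_above] at *
    refine ⟨fun x => h.1 (Equiv.swap i j x), ?_⟩
    rw [sum_comp_swap, sum_comp_swap, h.2]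
  have inv (n : Fin l → ℤ) : (n ∘ Equiv.swap i j) ∘ Equiv.swap i j = n := by funext x; simp
  refine Finset.sum_bij' (fun n _ => n ∘ Equiv.swap i j) (fun n _ => n ∘ Equiv.swap i j)
    (fun n hn => ?_) (fun n hn => key k n hn) (fun n _ => inv n) (fun n _ => inv n) fun n _ => ?_
  · have := key _ n hn
    rwa [inv] at this
  · rw [hf i j hij, neg_neg]

/-- Terms with `n i < k j` vanish; on the others both entries clear both lower bounds, so the swap
is a sign-reversing involution. It is applied with `j` the new last slot, to discard `k` having an
entry `≤ -l`. -/
theorem sum_above_eq_zero (hf : ∀ i j, i ≠ j → ∀ k, f (k ∘ Equiv.swap i j) = -f k)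
    {i j : Fin l} (hij : i ≠ j) {k : Fin l → ℤ} (hk : k i ≤ k j)
    (h0 : ∀ n x, n x < k j → f n = 0) (c : ℕ) :
    ∑ n ∈ above k c, f n = 0 := by
  rw [← Finset.sum_filter_of_ne (p := fun n => k j ≤ n i)
    (fun n _ h => not_lt.1 fun h' => h (h0 n i h'))]
  refine sum_eq_zero_of_swap i j _ f (fun n hn => ?_) (hf i j hij)
  rw [Finset.mem_filter] at *
  have h := (mem_above.1 hn.1).1 j
  exact ⟨comp_swap_mem_above hn.1 (hk.trans h) hn.2, by rwa [comp_swap_apply_left]⟩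

end

theorem alt_swap {l : ℕ} (i j : Fin l) (hij : i ≠ j) (n : Fin l → ℤ) :
    alt (n ∘ Equiv.swap i j) = -alt n :=
  sVec_swap hij n

/-- Up to sign the small entry can be moved to the last slot, where adding the staircase leaves it
negative. -/
theorem alt_eq_zero {l : ℕ} {n : Fin (l + 1) → ℤ} {x : Fin (l + 1)} (h : n x < -(l : ℤ)) :
    alt n = 0 := by
  have last (n : Fin (l + 1) → ℤ) (h : n (Fin.last l) < -(l : ℤ)) : alt n = 0 := by
    refine sVec_eq_zero_of_last_neg ?_
    rw [Pi.add_apply, staircase_last]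
    omega
  rcases eq_or_ne x (Fin.last l) with rfl | hx
  · exact last n h
  · rw [← neg_eq_zero, ← alt_swap _ _ hx]
    exact last _ (by rwa [comp_swap_apply_right])

theorem snoc_comp_swap {l : ℕ} (i j : Fin l) (k : Fin l → ℤ) (a : ℤ) :
    (Fin.snoc (k ∘ Equiv.swap i j) a : Fin (l + 1) → ℤ) =
      (Fin.snoc k a : Fin (l + 1) → ℤ) ∘ Equiv.swap i.castSucc j.castSucc := by
  funext x
  refine Fin.lastCases ?_ (fun x => ?_) x
  · rw [comp_swap_apply_of_ne _ (Fin.castSucc_lt_last i).ne' (Fin.castSucc_lt_last j).ne']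
    simp
  · rw [Fin.snoc_castSucc]
    rcases eq_or_ne x i with rfl | hxi
    · simp
    · rcases eq_or_ne x j with rfl | hxj
      · simp
      · rw [comp_swap_apply_of_ne _ hxi hxj, comp_swap_apply_of_ne]
        · simp
        · simpa using hxi
        · simpa using hxj

open scoped Classical in
theorem alt_mul_hNat {l : ℕ} {m : Fin l → ℤ} (hm : Antitone m) (r : ℕ) :
    alt m * hNat r = ∑ a ∈ Finset.range (r + 1), theta ^ a •
      ∑ k ∈ below m a with
        (∀ i j : Fin l, (i : ℕ) + 1 = j → m j < k i) ∧ ∀ i, -(l : ℤ) < k i,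
      ∑ n ∈ above (Fin.snoc k (-(l : ℤ)) : Fin (l + 1) → ℤ) (r - a) with
        ∀ i j : Fin (l + 1), (i : ℕ) + 1 = j →
          n j < (Fin.snoc k (-(l : ℤ)) : Fin (l + 1) → ℤ) i, alt n := by
  rw [sVec_mul_hNat]
  refine Finset.sum_congr rfl fun a _ => congrArg _ ?_
  -- The inner sum over `n` is itself alternating in `k`, so the outer cancellation comes first.
  -- Once `k` interlaces with `m` and exceeds `-l`, the vector `(k, -l)` is decreasing and the inner
  -- cancellation applies.
  rw [sum_below_eq (fun i j hij k => ?_) hm,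
    ← Finset.sum_filter_of_ne (p := fun k => ∀ i, -(l : ℤ) < k i), Finset.filter_filter]
  · refine Finset.sum_congr rfl fun k hk => sum_above_eq alt_swap ?_ _
    obtain ⟨hk, hk1, hk2⟩ := Finset.mem_filter.1 hk
    refine Fin.antitone_iff_succ_le.2 fun i => ?_
    rw [Fin.snoc_castSucc]
    rcases Nat.lt_or_ge (i + 1) l with h | h
    · have : i.succ = (⟨i + 1, h⟩ : Fin l).castSucc := Fin.ext rfl
      rw [this, Fin.snoc_castSucc]
      exact ((mem_below.1 hk).1 _).trans (hk1 i ⟨i + 1, h⟩ rfl).le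
    · have : i.succ = Fin.last l := Fin.ext (by rw [Fin.val_succ, Fin.val_last]; omega)
      rw [this, Fin.snoc_last]
      exact (hk2 i).le
  · intro k _ h i
    by_contra hi
    refine h (sum_above_eq_zero alt_swap (Fin.castSucc_lt_last i).ne ?_ (fun n x hx => ?_) _)
    · simpa using hi
    · rw [Fin.snoc_last] at hx
      exact alt_eq_zero hx
  · rw [snoc_comp_swap]
    exact sum_above_comp_swap alt_swap (by simpa using hij) _ _

/-! ### Partitions as decreasing vectors -/

theorem rowLen_eq_zero_iff (lam : YoungDiagram) (n : ℕ) : lam.rowLen n = 0 ↔ lam.colLen 0 ≤ n := by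
  rw [← not_lt, ← YoungDiagram.mem_iff_lt_colLen, YoungDiagram.mem_iff_lt_rowLen, not_lt,
    Nat.le_zero]

theorem eq_of_rowLen_eq {lam ν : YoungDiagram} (h : ∀ i, lam.rowLen i = ν.rowLen i) : lam = ν := by
  refine YoungDiagram.ext (Finset.ext ?_)
  rintro ⟨i, j⟩
  rw [YoungDiagram.mem_cells, YoungDiagram.mem_cells, YoungDiagram.mem_iff_lt_rowLen,
    YoungDiagram.mem_iff_lt_rowLen, h]

theorem le_iff_rowLen_le {ν μ : YoungDiagram} : ν ≤ μ ↔ ∀ i, ν.rowLen i ≤ μ.rowLen i := by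
  rw [← YoungDiagram.cells_subset_iff]
  constructor
  · intro h i
    by_contra! hi
    exact lt_irrefl _ (YoungDiagram.mem_iff_lt_rowLen.1
      (h (YoungDiagram.mem_cells (i, μ.rowLen i) |>.2 (YoungDiagram.mem_iff_lt_rowLen.2 hi))))
  · rintro h ⟨i, j⟩ hij
    rw [YoungDiagram.mem_cells, YoungDiagram.mem_iff_lt_rowLen] at *
    exact hij.trans_le (h i)

theorem horizontalStrip_iff {ν μ : YoungDiagram} : HorizontalStrip ν μ ↔
    ∀ i, ν.rowLen i ≤ μ.rowLen i ∧ μ.rowLen (i + 1) ≤ ν.rowLen i := by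
  rw [HorizontalStrip, le_iff_rowLen_le, forall_and]
  refine and_congr_right fun _ => ⟨fun h i => ?_, fun h j => ?_⟩
  · by_contra! hi
    -- If `μ_{i+1} > ν_i`, then column `ν_i` contains two boxes of `μ - ν`, in rows `i` and `i + 1`.
    have h1 : i + 1 < μ.colLen (ν.rowLen i) :=
      YoungDiagram.mem_iff_lt_colLen.1 (YoungDiagram.mem_iff_lt_rowLen.2 hi)
    have h2 : ¬ i < ν.colLen (ν.rowLen i) := fun h' => lt_irrefl _
      (YoungDiagram.mem_iff_lt_rowLen.1 (YoungDiagram.mem_iff_lt_colLen.2 h'))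
    have := h (ν.rowLen i)
    omega
  · by_contra! hj
    have h1 : j < μ.rowLen (ν.colLen j + 1) :=
      YoungDiagram.mem_iff_lt_rowLen.1 (YoungDiagram.mem_iff_lt_colLen.2 hj)
    have h2 : ¬ j < ν.rowLen (ν.colLen j) := fun h' => lt_irrefl _
      (YoungDiagram.mem_iff_lt_colLen.1 (YoungDiagram.mem_iff_lt_rowLen.2 h'))
    have := h (ν.colLen j)
    omega

theorem card_eq_sum_rowLen {lam : YoungDiagram} {n : ℕ} (h : lam.colLen 0 ≤ n) :
    lam.card = ∑ i : Fin n, lam.rowLen i := by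
  have hmaps : ∀ c ∈ lam.cells, c.1 ∈ Finset.range n := by
    rintro ⟨i, j⟩ hc
    have h1 : i < lam.colLen j := YoungDiagram.mem_iff_lt_colLen.1 hc
    have := lam.colLen_anti 0 j (Nat.zero_le j)
    exact Finset.mem_range.2 (by omega)
  rw [Finset.sum_fin_eq_sum_range, YoungDiagram.card,
    Finset.card_eq_sum_card_fiberwise hmaps]
  refine Finset.sum_congr rfl fun i hi => ?_
  rw [dif_pos (Finset.mem_range.1 hi), YoungDiagram.rowLen_eq_card]
  rfl

theorem iSchur_eq_sVec (lam : YoungDiagram) {n : ℕ} (h : lam.colLen 0 ≤ n) :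
    iSchur lam = sVec fun i : Fin n => (lam.rowLen i : ℤ) := by
  induction n, h using Nat.le_induction with
  | base => rfl
  | succ n hn ih =>
    rw [ih, ← sVec_snoc_zero]
    congr 1
    funext i
    refine Fin.lastCases ?_ (fun i => ?_) i
    · simp [(rowLen_eq_zero_iff lam n).2 hn]
    · simp

/-- The decreasing vector `λ_i - i` of length `n` attached to a partition. -/
def shifted (n : ℕ) (lam : YoungDiagram) : Fin n → ℤ := fun i => lam.rowLen i - i

theorem alt_shifted (lam : YoungDiagram) {n : ℕ} (h : lam.colLen 0 ≤ n) :
    alt (shifted n lam) = iSchur lam := by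
  rw [iSchur_eq_sVec lam h, alt]
  congr 1
  funext i
  simp [shifted, staircase]

theorem shifted_antitone (n : ℕ) (lam : YoungDiagram) : Antitone (shifted n lam) := by
  intro i j hij
  have := lam.rowLen_anti i j hij
  have h : (i : ℕ) ≤ j := hij
  simp only [shifted]
  omega

theorem sum_shifted {lam : YoungDiagram} {n : ℕ} (h : lam.colLen 0 ≤ n) :
    ∑ i, shifted n lam i = lam.card - ∑ i : Fin n, (i : ℤ) := by
  simp only [shifted]
  rw [Finset.sum_sub_distrib, card_eq_sum_rowLen h]
  push_cast
  rfl

theorem shifted_injective {lam ν : YoungDiagram} {n : ℕ} (h : lam.colLen 0 ≤ n)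
    (h' : ν.colLen 0 ≤ n) (heq : shifted n lam = shifted n ν) : lam = ν := by
  refine eq_of_rowLen_eq fun i => ?_
  rcases Nat.lt_or_ge i n with hi | hi
  · have := congrFun heq ⟨i, hi⟩
    simp only [shifted] at this
    omega
  · rw [(rowLen_eq_zero_iff _ _).2 (h.trans hi), (rowLen_eq_zero_iff _ _).2 (h'.trans hi)]

theorem snoc_shifted {ν : YoungDiagram} {l : ℕ} (h : ν.colLen 0 ≤ l) :
    (Fin.snoc (shifted l ν) (-(l : ℤ)) : Fin (l + 1) → ℤ) = shifted (l + 1) ν := by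
  funext i
  refine Fin.lastCases ?_ (fun i => ?_) i
  · simp [shifted, (rowLen_eq_zero_iff ν l).2 h]
  · simp [shifted]

theorem horizontalStrip_iff_shifted {ν μ : YoungDiagram} {n : ℕ} (hν : ν.colLen 0 ≤ n)
    (hμ : μ.colLen 0 ≤ n) : HorizontalStrip ν μ ↔ (∀ i, shifted n ν i ≤ shifted n μ i) ∧
      ∀ i j : Fin n, (i : ℕ) + 1 = j → shifted n μ j < shifted n ν i := by
  rw [horizontalStrip_iff]
  constructor
  · refine fun h => ⟨fun i => ?_, fun i j hij => ?_⟩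
    · have := (h i).1
      simp only [shifted]
      omega
    · have := (h i).2
      simp only [shifted]
      rw [← hij]
      push_cast
      omega
  · rintro ⟨h1, h2⟩ i
    rcases Nat.lt_or_ge i n with hi | hi
    · have := h1 ⟨i, hi⟩
      simp only [shifted] at this
      refine ⟨by omega, ?_⟩
      rcases Nat.lt_or_ge (i + 1) n with hi' | hi'
      · have := h2 ⟨i, hi⟩ ⟨i + 1, hi'⟩ rfl
        simp only [shifted] at this
        push_cast at this
        omega
      · rw [(rowLen_eq_zero_iff _ _).2 (hμ.trans hi')]
        exact Nat.zero_le _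
    · rw [(rowLen_eq_zero_iff _ _).2 (hν.trans hi), (rowLen_eq_zero_iff _ _).2 (hμ.trans hi),
        (rowLen_eq_zero_iff _ _).2 (hμ.trans (hi.trans (Nat.le_succ i)))]
      simp

/-- Strict decrease of the integers `k_i` is weak decrease of the row lengths `k_i + i`. -/
theorem exists_shifted_eq {n : ℕ} (k : Fin n → ℤ) (h0 : ∀ i, 0 ≤ k i + i)
    (hk : ∀ i j : Fin n, (i : ℕ) + 1 = j → k j < k i) :
    ∃ lam : YoungDiagram, lam.colLen 0 ≤ n ∧ shifted n lam = k := by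
  have hanti : Antitone fun i : Fin n => (k i + i).toNat := by
    cases n with
    | zero => exact fun i => i.elim0
    | succ n =>
      refine Fin.antitone_iff_succ_le.2 fun i => Int.toNat_le_toNat ?_
      have := hk i.castSucc i.succ rfl
      simp only [Fin.val_succ, Fin.val_castSucc]
      push_cast
      omega
  have hlen : (List.ofFn fun i : Fin n => (k i + i).toNat).length = n := List.length_ofFn
  refine ⟨YoungDiagram.ofRowLens (List.ofFn fun i => (k i + i).toNat) hanti.sortedGE_ofFn, ?_, ?_⟩
  · rw [← not_lt, ← YoungDiagram.mem_iff_lt_colLen, YoungDiagram.mem_ofRowLens]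
    rintro ⟨h, -⟩
    exact h.ne hlen.symm
  · funext i
    have := YoungDiagram.rowLen_ofRowLens (hw := hanti.sortedGE_ofFn) (i.cast hlen.symm)
    simp only [Fin.val_cast] at this
    rw [shifted, this]
    have := h0 i
    simp
    omega

theorem colLen_le_of_le {ν μ : YoungDiagram} (h : ν ≤ μ) {n : ℕ} (hμ : μ.colLen 0 ≤ n) :
    ν.colLen 0 ≤ n := by
  rw [← rowLen_eq_zero_iff] at *
  have := le_iff_rowLen_le.1 h n
  omega

theorem HorizontalStrip.colLen_le {ν lam : YoungDiagram} (h : HorizontalStrip ν lam) {n : ℕ}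
    (hν : ν.colLen 0 ≤ n) : lam.colLen 0 ≤ n + 1 := by
  rw [← rowLen_eq_zero_iff] at *
  have := (horizontalStrip_iff.1 h n).2
  omega

/-! ### Matching the surviving vectors with pairs of horizontal strips -/

theorem finite_pieri (lam μ : YoungDiagram) (r : ℕ) :
    {ν : YoungDiagram | HorizontalStrip ν μ ∧ HorizontalStrip ν lam ∧
      (μ.cells \ ν.cells).card + (lam.cells \ ν.cells).card = r}.Finite := by
  refine Set.Finite.of_finite_image (f := YoungDiagram.cells) ?_
    (fun a _ b _ h => YoungDiagram.ext h)
  refine (Finset.finite_toSet μ.cells.powerset).subset ?_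
  rintro _ ⟨ν, hν, rfl⟩
  exact Finset.mem_coe.2 (Finset.mem_powerset.2 (YoungDiagram.cells_subset_iff.2 hν.1.1))

theorem mem_partitions {n : ℤ} {lam : YoungDiagram} : lam ∈ partitions n ↔ (lam.card : ℤ) = n :=
  (finite_partitions n).mem_toFinset

theorem card_sdiff_cells {ν μ : YoungDiagram} (h : ν ≤ μ) :
    ((μ.cells \ ν.cells).card : ℤ) = μ.card - ν.card := by
  have h' := YoungDiagram.cells_subset_iff.2 h
  rw [Finset.card_sdiff_of_subset h', Nat.cast_sub (Finset.card_le_card h')]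

open scoped Classical in
theorem sum_partitions_pieriNumber (μ : YoungDiagram) (r a : ℕ) (ha : a ≤ r) {l : ℕ}
    (hμ : μ.colLen 0 ≤ l) :
    ∑ lam ∈ partitions ((μ.card : ℤ) + (r : ℤ) - 2 * (a : ℤ)),
        (pieriNumber lam μ r : ℚ[X]) • iSchur lam =
      ∑ k ∈ below (shifted l μ) a with
        (∀ i j : Fin l, (i : ℕ) + 1 = j → shifted l μ j < k i) ∧
          ∀ i, -(l : ℤ) < k i,
      ∑ n ∈ above (Fin.snoc k (-(l : ℤ)) : Fin (l + 1) → ℤ) (r - a) with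
        ∀ i j : Fin (l + 1), (i : ℕ) + 1 = j →
          n j < (Fin.snoc k (-(l : ℤ)) : Fin (l + 1) → ℤ) i, alt n := by
  have hN (lam : YoungDiagram) : (pieriNumber lam μ r : ℚ[X]) • iSchur lam =
      ∑ ν ∈ (finite_pieri lam μ r).toFinset, iSchur lam := by
    rw [Finset.sum_const, pieriNumber, Set.ncard_eq_toFinset_card _ (finite_pieri lam μ r),
      Nat.cast_smul_eq_nsmul]
  simp_rw [hN]
  rw [Finset.sum_sigma', Finset.sum_sigma']
  -- Fixing `|λ| = |μ| + r - 2a` turns the total box count `r` into the two counts `|μ - ν| = a` and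
  -- `|λ - ν| = r - a`.
  have hS (x : (_ : YoungDiagram) × YoungDiagram) :
      x ∈ (partitions ((μ.card : ℤ) + (r : ℤ) - 2 * (a : ℤ))).sigma
        (fun lam => (finite_pieri lam μ r).toFinset) ↔
      HorizontalStrip x.2 μ ∧ HorizontalStrip x.2 x.1 ∧ (x.2.card : ℤ) + a = μ.card ∧
        (x.1.card : ℤ) = x.2.card + (r - a) := by
    rw [Finset.mem_sigma, mem_partitions, Set.Finite.mem_toFinset, Set.mem_ofPred_eq]
    constructor
    · rintro ⟨h1, h2, h3, h4⟩
      zify at h4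
      rw [card_sdiff_cells h2.1, card_sdiff_cells h3.1] at h4
      exact ⟨h2, h3, by omega, by omega⟩
    · rintro ⟨h2, h3, h4, h5⟩
      refine ⟨by omega, h2, h3, ?_⟩
      zify
      rw [card_sdiff_cells h2.1, card_sdiff_cells h3.1]
      omega
  refine Finset.sum_bij (fun x _ => ⟨shifted l x.2, shifted (l + 1) x.1⟩) ?_ ?_ ?_ ?_
  · rintro ⟨lam, ν⟩ hx
    obtain ⟨h1, h2, h3, h4⟩ := (hS _).1 hx
    dsimp only at h1 h2 h3 h4 ⊢
    have hν := colLen_le_of_le h1.1 hμ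
    have hν1 : ν.colLen 0 ≤ l + 1 := hν.trans (Nat.le_succ l)
    have hlam := h2.colLen_le hν
    have hs1 := (horizontalStrip_iff_shifted hν hμ).1 h1
    have hs2 := (horizontalStrip_iff_shifted hν1 hlam).1 h2
    rw [Finset.mem_sigma, Finset.mem_filter, Finset.mem_filter, mem_below, mem_above,
      snoc_shifted hν, sum_shifted hν, sum_shifted hμ, sum_shifted hlam,
      sum_shifted hν1]
    refine ⟨⟨⟨hs1.1, by omega⟩, hs1.2, fun i => ?_⟩, ⟨hs2.1, by omega⟩, hs2.2⟩
    simp only [shifted]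
    omega
  · rintro ⟨lam, ν⟩ hx ⟨lam', ν'⟩ hx' heq
    obtain ⟨h1, h2, -⟩ := (hS _).1 hx
    obtain ⟨h1', h2', -⟩ := (hS _).1 hx'
    rw [Sigma.mk.injEq] at heq
    have hν := colLen_le_of_le h1.1 hμ
    have hν' := colLen_le_of_le h1'.1 hμ
    obtain rfl : ν = ν' := shifted_injective hν hν' heq.1
    obtain rfl : lam = lam' :=
      shifted_injective (h2.colLen_le hν) (h2'.colLen_le hν') (eq_of_heq heq.2)
    rfl
  · rintro ⟨k, n⟩ hx
    rw [Finset.mem_sigma, Finset.mem_filter, Finset.mem_filter, mem_below, mem_above] at hx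
    obtain ⟨⟨⟨hk1, hk2⟩, hk3, hk4⟩, ⟨hn1, hn2⟩, hn3⟩ := hx
    dsimp only at hk1 hk2 hk3 hk4 hn1 hn2 hn3
    -- Nonnegativity of the rows of `ν` follows from `k_i > μ_{i+1} - (i + 1)`, except in the last
    -- row, where `k_i > -l` is needed.
    obtain ⟨ν, hν, rfl⟩ := exists_shifted_eq k (fun i => by
      rcases Nat.lt_or_ge (i + 1) l with h | h
      · have := hk3 i ⟨i + 1, h⟩ rfl
        simp only [shifted] at this
        push_cast at this
        omega
      · have := hk4 i
        omega) (fun i j hij => (hk1 j).trans_lt (hk3 i j hij))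
    have hν1 : ν.colLen 0 ≤ l + 1 := hν.trans (Nat.le_succ l)
    rw [snoc_shifted hν] at hn1 hn2 hn3
    obtain ⟨lam, hlam, rfl⟩ := exists_shifted_eq n (fun i => by
      have := hn1 i
      simp only [shifted] at this
      omega) (fun i j hij => (hn3 i j hij).trans_le (hn1 i))
    refine ⟨⟨lam, ν⟩, (hS _).2 ?_, rfl⟩
    rw [sum_shifted hν, sum_shifted hμ] at hk2
    rw [sum_shifted hlam, sum_shifted hν1] at hn2
    exact ⟨(horizontalStrip_iff_shifted hν hμ).2 ⟨hk1, hk3⟩,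
      (horizontalStrip_iff_shifted hν1 hlam).2 ⟨hn1, hn3⟩,
      by dsimp only; omega, by dsimp only; omega⟩
  · rintro ⟨lam, ν⟩ hx
    obtain ⟨h1, h2, -⟩ := (hS _).1 hx
    exact (alt_shifted lam (h2.colLen_le (colLen_le_of_le h1.1 hμ))).symm

end ISchur

end

theorem mainTheorem8 (μ : YoungDiagram) (r : ℕ) (hr : 1 ≤ r) :
    ISchur.iSchur μ * ISchur.hNat r =
      ∑ a ∈ Finset.range (r + 1),
        ∑ lam ∈ ISchur.partitions ((μ.card : ℤ) + (r : ℤ) - 2 * (a : ℤ)),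
          (ISchur.theta ^ a * (ISchur.pieriNumber lam μ r : Polynomial ℚ)) •
            ISchur.iSchur lam := by
  rw [← ISchur.alt_shifted μ le_rfl, ISchur.alt_mul_hNat (ISchur.shifted_antitone _ μ)]
  refine Finset.sum_congr rfl fun a ha => ?_
  rw [← ISchur.sum_partitions_pieriNumber μ r a (Nat.lt_succ_iff.1 (Finset.mem_range.1 ha)) le_rfl,
    Finset.smul_sum]
  exact Finset.sum_congr rfl fun lam _ => smul_smul _ _ _
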